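/- Let $k\ge 0$ be an integer and let $C\subseteq\mathbb{R}^m$ be a proper convex cone, that is, a closed convex cone with $C\cap(-C)=\{0\}$ and $\operatorname{span}(C)=\mathbb{R}^m$, where $\mathbb{R}^m$ carries a fixed inner product $\langle\cdot,\cdot\rangle$ with norm $\|\cdot\|$. Let $C^*=\{f : \langle f,x\rangle\ge 0 \text{ for all } x\in C\}$ be the dual cone. A set $F\subseteq C$ is called a face of $C$ if it is convex and, whenever $x,y\in C$ and $\alpha x+(1-\alpha)y\in F$ for some $\alpha\in(0,1)$, also $x,y\in F$. Let $\operatorname{ext}(C)$ be the set of vectors $v$ with $\|v\|=1$ such that the ray $\mathbb{R}_+v=\{tv : t\ge 0\}$ is a face of $C$. For $V\subseteq\operatorname{ext}(C)$, say that $C$ is $k$-neighborly with respect to $V$ if for every $k$-element subset $W\subseteq V$ there is $f_W\in C^*$ with $\langle f_W,v\rangle=0$ for all $v\in W$ and $\langle f_W,v\rangle>0$ for all $v\in V\setminus W$. Suppose that for every $N\in\mathbb{N}$ there is a subset $V_N\subseteq\operatorname{ext}(C)$ with $|V_N|\ge N$ such that $C$ is $k$-neighborly with respect to $V_N$. Let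 $p$ be a homogeneous polynomial in $n$ variables with real coefficients which is hyperbolic with respect to $e\in\mathbb{R}^n$, i.e. $p(e)>0$ and for every $x\in\mathbb{R}^n$ the univariate polynomial $t\mapsto p(te-x)$ has only real roots, and let $$\Lambda_+(p,e)=\{x\in\mathbb{R}^n : \text{all roots of } t\mapsto p(te-x) \text{ are nonnegative}\}$$ be its hyperbolicity cone. Suppose that every irreducible factor of $p$ in $\mathbb{R}[x_1,\dots,x_n]$ has degree at most $k$. Then $C$ has no $\Lambda_+(p,e)$-lift: there are no linear map $\pi:\mathbb{R}^n\to\mathbb{R}^m$ and linear subspace $L\subseteq\mathbb{R}^n$ such that $C=\pi(\Lambda_+(p,e)\cap L)$. -/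

import Mathlib

namespace ConeLift

/-- A convex cone in a real vector space with a topology is *proper* if it is closed, pointed
(contains no line, and contains the origin), and full-dimensional. -/
structure IsProper {E : Type*} [NormedAddCommGroup E] [InnerProductSpace ℝ E]
    (C : ConvexCone ℝ E) : Prop where
  isClosed : IsClosed (C : Set E)
  pointed : (C : Set E) ∩ -(C : Set E) = {0}
  fullDimensional : Submodule.span ℝ (C : Set E) = ⊤

/-- The ray `ℝ₊ v` generated by `v`. -/
def ray {E : Type*} [AddCommGroup E] [Module ℝ E] (v : E) : Set E :=
  {x | ∃ t : ℝ, 0 ≤ t ∧ x = t • v}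

/-- The set `ext(C)` of normalized extreme rays of `C`: the unit vectors `v` such that the ray
`ℝ₊ v` is a face of `C`. (`IsExtreme ℝ C F` says that `F ⊆ C` and that, whenever a point of `F`
lies in the open segment between two points of `C`, both of these points belong to `F`.) -/
def normalizedExtremeRays {E : Type*} [NormedAddCommGroup E] [InnerProductSpace ℝ E]
    (C : ConvexCone ℝ E) : Set E :=
  {v | ‖v‖ = 1 ∧ IsExtreme ℝ (C : Set E) (ray v)}

/-- `C` is `k`-neighborly with respect to `V`: for every `k`-element subset `W` of `V` there is
a functional `f` in the dual cone of `C` that vanishes on `W` and is positive on `V \ W`. -/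
def IsNeighborly {E : Type*} [NormedAddCommGroup E] [InnerProductSpace ℝ E]
    (k : ℕ) (C : ConvexCone ℝ E) (V : Set E) : Prop :=
  ∀ W : Finset E, (W : Set E) ⊆ V → W.card = k →
    ∃ f : E, (∀ x ∈ C, 0 ≤ inner ℝ f x) ∧
      (∀ v ∈ V, v ∉ W → 0 < inner ℝ f v) ∧ (∀ v ∈ W, inner ℝ f v = 0)

/-- `C` has a `K`-lift: `C = π (K ∩ L)` for a linear map `π` and a linear subspace `L`. -/
def HasLift {E F : Type*} [AddCommGroup E] [Module ℝ E] [AddCommGroup F] [Module ℝ F]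
    (C : Set E) (K : Set F) : Prop :=
  ∃ (π : F →ₗ[ℝ] E) (L : Submodule ℝ F), C = π '' (K ∩ (L : Set F))

/-- The univariate polynomial `t ↦ p (t e - x)`. -/
noncomputable def charPoly {n : ℕ} (p : MvPolynomial (Fin n) ℝ) (e x : Fin n → ℝ) :
    Polynomial ℝ :=
  MvPolynomial.aeval (fun i => Polynomial.X * Polynomial.C (e i) - Polynomial.C (x i)) p

/-- `p` is hyperbolic with respect to `e`: it is homogeneous, positive at `e`, and for every real
vector `x` all the complex roots of `t ↦ p (t e - x)` are real. -/
structure IsHyperbolic {n : ℕ} (p : MvPolynomial (Fin n) ℝ) (e : Fin n → ℝ) : Prop where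
  homogeneous : ∃ d : ℕ, p.IsHomogeneous d
  pos : 0 < MvPolynomial.eval e p
  realRooted : ∀ (x : Fin n → ℝ) (z : ℂ), Polynomial.aeval z (charPoly p e x) = 0 → z.im = 0

/-- The hyperbolicity cone `Λ₊(p, e)`: the vectors `x` all of whose hyperbolic eigenvalues, the
roots of `t ↦ p (t e - x)`, are nonnegative. -/
def hyperbolicityCone {n : ℕ} (p : MvPolynomial (Fin n) ℝ) (e : Fin n → ℝ) :
    Set (Fin n → ℝ) :=
  {x | ∀ t : ℝ, (charPoly p e x).IsRoot t → 0 ≤ t}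

end ConeLift

/-! Suppose `C = π(Λ₊ ∩ L)` and lift each `v ∈ C` to `y v ∈ Λ₊ ∩ L`. The cone `Λ₊` is the
intersection of the cones of the irreducible factors of `p`, each hyperbolic (up to sign) of degree
`d ≤ k`. For a finite set `S` let `z_S = ∑ v ∈ S, y v`; its rank for a factor is `d` minus the
multiplicity of the eigenvalue `0`. Adding `y u` either raises this rank or `z_S - ε y u` stays in
the cone of that factor for small `ε > 0` (`eventually_sub_mem`).

A pigeonhole argument (`exists_card_eq_forall_closure_or_rank_le`) finds in a large `V` a `k`-set
`S` and some `u ∉ S` such that, for each factor, `u` is absorbed in this sense or the rank is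
already at least `k ≥ d` and cannot rise. So `z_S - ε y u ∈ Λ₊ ∩ L`, and its image lies in `C`; but
the functional given by neighborliness for `S` takes the value `-ε ⟨f, u⟩ < 0` there.

The facts on hyperbolicity cones follow Gårding: for `x`, `y` in the cone and `t > 0`, the
polynomial `s ↦ q (x + t e + s y)` has nonnegative coefficients (`coeff_pencil_nonneg`). -/

namespace ConeLift

open Polynomial Finset

/-! ### Homogeneous polynomials, their factors, and restriction to lines. -/

section Homogeneous

variable {n : ℕ}

/-- A homogeneous polynomial scales with its degree. -/
theorem aeval_mul_of_isHomogeneous {A : Type*} [CommRing A] [Algebra ℝ A]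
    {q : MvPolynomial (Fin n) ℝ} {d : ℕ} (hq : q.IsHomogeneous d) (c : A) (w : Fin n → A) :
    MvPolynomial.aeval (fun i => c * w i) q = c ^ d * MvPolynomial.aeval w q := by
  rw [MvPolynomial.aeval_def, MvPolynomial.aeval_def, MvPolynomial.eval₂_eq',
    MvPolynomial.eval₂_eq', Finset.mul_sum]
  refine Finset.sum_congr rfl fun s hs => ?_
  have h := hq.degree_eq_sum_deg_support hs
  have h2 : ∑ i, s i = d := by
    rw [h]
    exact (Finset.sum_subset (Finset.subset_univ _) (by simp)).symm
  simp only [mul_pow, Finset.prod_mul_distrib, Finset.prod_pow_eq_pow_sum, h2]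
  ring

/-- The substitution `xᵢ ↦ T xᵢ` turns the grading into powers of `T`, so homogeneity of a factor
becomes a question about degrees in one variable. -/
theorem coeff_aeval_X_mul_C (q : MvPolynomial (Fin n) ℝ) (j : ℕ) :
    (MvPolynomial.aeval (fun i => X * C (MvPolynomial.X i : MvPolynomial (Fin n) ℝ)) q).coeff j
      = MvPolynomial.homogeneousComponent j q := by
  induction q using MvPolynomial.induction_on' with
  | monomial s c =>
    have h : MvPolynomial.aeval (fun i => X * C (MvPolynomial.X i : MvPolynomial (Fin n) ℝ))
        (MvPolynomial.monomial s c) = C (MvPolynomial.monomial s c) * X ^ s.degree := by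
      rw [MvPolynomial.aeval_monomial, MvPolynomial.monomial_eq, Finsupp.degree_eq_sum,
        Finsupp.prod_fintype _ _ (by simp), Finsupp.prod_fintype _ _ (by simp)]
      simp only [mul_pow, Finset.prod_mul_distrib, Finset.prod_pow_eq_pow_sum, map_mul,
        map_prod, map_pow]
      rw [IsScalarTower.algebraMap_apply ℝ (MvPolynomial (Fin n) ℝ) (Polynomial _)]
      simp only [MvPolynomial.algebraMap_eq, Polynomial.algebraMap_eq]
      ring
    rw [h, coeff_C_mul_X_pow]
    split_ifs with hj
    · subst hj
      exact (MvPolynomial.homogeneousComponent_eq_self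
        (MvPolynomial.isHomogeneous_monomial _ rfl)).symm
    · rw [MvPolynomial.homogeneousComponent_of_mem
        (MvPolynomial.isHomogeneous_monomial c (rfl : s.degree = _)), if_neg hj]
  | add p q hp hq => simp only [map_add, coeff_add, hp, hq]

/-- A factor of a nonzero homogeneous polynomial is homogeneous. -/
theorem exists_isHomogeneous_of_dvd {p q : MvPolynomial (Fin n) ℝ} {d : ℕ}
    (hp : p.IsHomogeneous d) (hp0 : p ≠ 0) (hqp : q ∣ p) : ∃ a, q.IsHomogeneous a := by
  obtain ⟨r, rfl⟩ := hqp
  set Q := MvPolynomial.aeval (R := ℝ)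
    (fun i => X * C (MvPolynomial.X i : MvPolynomial (Fin n) ℝ)) with hQ
  have hprod : Q q * Q r = C (q * r) * X ^ d := by
    rw [← map_mul]
    ext1 j
    rw [hQ, coeff_aeval_X_mul_C, coeff_C_mul_X_pow, MvPolynomial.homogeneousComponent_of_mem hp]
  have h0 : Q q * Q r ≠ 0 := by
    rw [hprod]; exact mul_ne_zero (by simpa using hp0) (pow_ne_zero _ X_ne_zero)
  have hq0 := left_ne_zero_of_mul h0
  have hr0 := right_ne_zero_of_mul h0
  -- Degree and trailing degree are both additive and agree on the product `C (q * r) * X ^ d`;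
  -- hence they agree on each factor, which is a single power of `T`.
  have hd1 : (Q q).natDegree + (Q r).natDegree = d := by
    rw [← natDegree_mul hq0 hr0, hprod, natDegree_C_mul_X_pow _ _ hp0]
  have hd2 : (Q q).natTrailingDegree + (Q r).natTrailingDegree = d := by
    rw [← natTrailingDegree_mul hq0 hr0, hprod, C_mul_X_pow_eq_monomial,
      natTrailingDegree_monomial hp0]
  have hl1 := natTrailingDegree_le_natDegree (Q q)
  have hl2 := natTrailingDegree_le_natDegree (Q r)
  refine ⟨(Q q).natDegree, ?_⟩
  have hcomp : ∀ j, j ≠ (Q q).natDegree → MvPolynomial.homogeneousComponent j q = 0 := by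
    intro j hj
    rw [← coeff_aeval_X_mul_C, ← hQ]
    rcases lt_or_gt_of_ne hj with h | h
    · exact coeff_eq_zero_of_lt_natTrailingDegree (by omega)
    · exact coeff_eq_zero_of_natDegree_lt h
  set a := (Q q).natDegree
  rw [← MvPolynomial.sum_homogeneousComponent q]
  refine MvPolynomial.IsHomogeneous.sum _ _ _ fun j _ => ?_
  by_cases hj : j = a
  · rw [hj]; exact MvPolynomial.homogeneousComponent_isHomogeneous _ _
  · rw [hcomp j hj]; exact MvPolynomial.isHomogeneous_zero _ _ _

/-- The restriction `T ↦ q (a + T b)` of `q` to a line, as a univariate polynomial. -/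
noncomputable def pencil {A : Type*} [CommRing A] [Algebra ℝ A] (q : MvPolynomial (Fin n) ℝ)
    (a b : Fin n → A) : A[X] :=
  MvPolynomial.aeval (fun i => C (a i) + X * C (b i)) q

variable {A B : Type*} [CommRing A] [Algebra ℝ A] [CommRing B] [Algebra ℝ B]

theorem aeval_pencil [Algebra A B] [IsScalarTower ℝ A B] (q : MvPolynomial (Fin n) ℝ)
    (a b : Fin n → A) (s : B) :
    aeval s (pencil q a b)
      = MvPolynomial.aeval (fun i => algebraMap A B (a i) + s * algebraMap A B (b i)) q := by
  have h := MvPolynomial.comp_aeval (R := ℝ) (fun i => C (a i) + X * C (b i))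
    ((aeval s : A[X] →ₐ[A] B).restrictScalars ℝ)
  have h2 := congrArg (fun φ => φ q) h
  simp only [mul_comm s]
  simpa [pencil] using h2

theorem eval_pencil (q : MvPolynomial (Fin n) ℝ) (a b : Fin n → A) (s : A) :
    (pencil q a b).eval s = MvPolynomial.aeval (fun i => a i + s * b i) q := by
  have := aeval_pencil (B := A) q a b s
  simpa using this

theorem map_pencil (q : MvPolynomial (Fin n) ℝ) (a b : Fin n → A) (φ : A →ₐ[ℝ] B) :
    (pencil q a b).map (φ : A →+* B) = pencil q (fun i => φ (a i)) (fun i => φ (b i)) := by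
  have h := MvPolynomial.comp_aeval (R := ℝ) (fun i => C (a i) + X * C (b i))
    (Polynomial.mapAlgHom φ)
  have h2 := congrArg (fun ψ => ψ q) h
  simpa [pencil] using h2

theorem coeff_pencil_map (q : MvPolynomial (Fin n) ℝ) (a b : Fin n → A) (φ : A →ₐ[ℝ] B) (j : ℕ) :
    φ ((pencil q a b).coeff j) = (pencil q (fun i => φ (a i)) (fun i => φ (b i))).coeff j := by
  rw [← map_pencil, coeff_map]; rfl

theorem prod_linear_pow {A : Type*} [CommRing A] (a b : Fin n → A) (m : Fin n → ℕ) (s : Finset (Fin n)) :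
    (∏ i ∈ s, (C (a i) + X * C (b i)) ^ m i).natDegree ≤ ∑ i ∈ s, m i ∧
      (∏ i ∈ s, (C (a i) + X * C (b i)) ^ m i).coeff (∑ i ∈ s, m i) = ∏ i ∈ s, b i ^ m i := by
  induction s using Finset.induction_on with
  | empty => simp
  | insert i s hi ih =>
    have h1 : (C (a i) + X * C (b i)).natDegree ≤ 1 := by compute_degree
    have h2 : ((C (a i) + X * C (b i)) ^ m i).natDegree ≤ m i := by
      simpa using natDegree_pow_le_of_le (m i) h1
    have h3 : ((C (a i) + X * C (b i)) ^ m i).coeff (m i) = b i ^ m i := by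
      have := coeff_pow_of_natDegree_le (m := m i) h1
      simpa [mul_one] using this
    rw [Finset.prod_insert hi, Finset.sum_insert hi, Finset.prod_insert hi]
    exact ⟨natDegree_mul_le_of_le h2 ih.1, by
      rw [coeff_mul_add_eq_of_natDegree_le h2 ih.1, h3, ih.2]⟩

theorem pencil_degree {q : MvPolynomial (Fin n) ℝ} {d : ℕ} (hq : q.IsHomogeneous d)
    (a b : Fin n → A) :
    (pencil q a b).natDegree ≤ d ∧ (pencil q a b).coeff d = MvPolynomial.aeval b q := by
  have hs : ∀ s ∈ q.support, ∑ i, s i = d := fun s hs => by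
    rw [hq.degree_eq_sum_deg_support hs]
    exact (Finset.sum_subset (Finset.subset_univ _) (by simp)).symm
  have halg : ∀ c : ℝ, algebraMap ℝ A[X] c = C (algebraMap ℝ A c) := fun c => rfl
  rw [pencil, MvPolynomial.aeval_def, MvPolynomial.aeval_def, MvPolynomial.eval₂_eq',
    MvPolynomial.eval₂_eq']
  constructor
  · refine natDegree_sum_le_of_forall_le _ _ fun s h => ?_
    rw [halg]
    refine (natDegree_C_mul_le _ _).trans ?_
    simpa [hs s h] using (prod_linear_pow a b s univ).1
  · rw [finsetSum_coeff]
    refine Finset.sum_congr rfl fun s h => ?_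
    rw [halg, coeff_C_mul, ← (prod_linear_pow a b s univ).2, hs s h]

end Homogeneous

/-! ### Real polynomials: signs of coefficients and order of vanishing. -/

section RealRooted

/-- A real polynomial with positive leading coefficient all of whose complex roots are negative
reals has positive coefficients. -/
theorem coeff_pos_of_roots_neg : ∀ (m : ℕ) (P : ℝ[X]), P.natDegree = m → 0 < P.leadingCoeff →
    (∀ z : ℂ, aeval z P = 0 → z.im = 0 ∧ z.re < 0) → ∀ i ≤ m, 0 < P.coeff i := by
  intro m
  induction m with
  | zero =>
    intro P hP hl _ i hi
    obtain rfl : i = 0 := by omega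
    rwa [leadingCoeff, hP] at hl
  | succ m ih =>
    intro P hP hl hr i hi
    have hdeg : 0 < (P.map (algebraMap ℝ ℂ)).degree := by
      rw [degree_map]; exact natDegree_pos_iff_degree_pos.1 (by omega)
    obtain ⟨z, hz⟩ := Complex.exists_root hdeg
    rw [IsRoot, eval_map_algebraMap] at hz
    obtain ⟨him, hre⟩ := hr z hz
    have hzr : z = algebraMap ℝ ℂ z.re := by
      apply Complex.ext <;> simp [him]
    have hroot : P.IsRoot z.re := by
      rw [hzr, aeval_algebraMap_apply] at hz
      simpa using hz
    obtain ⟨Q, hQ⟩ := dvd_iff_isRoot.2 hroot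
    have hP0 : P ≠ 0 := by rintro rfl; simp at hl
    have hQ0 : Q ≠ 0 := by rintro rfl; simp [hP0] at hQ
    have hQd : Q.natDegree = m := by
      have := natDegree_mul (X_sub_C_ne_zero z.re) hQ0
      rw [← hQ, hP, natDegree_X_sub_C] at this
      omega
    have hQl : 0 < Q.leadingCoeff := by
      rw [hQ, leadingCoeff_mul, leadingCoeff_X_sub_C, one_mul] at hl
      exact hl
    have hQr := ih Q hQd hQl fun w hw => hr w (by rw [hQ, map_mul, hw, mul_zero])
    rw [hQ, sub_mul]
    cases i with
    | zero =>
      simp only [coeff_sub, mul_coeff_zero, coeff_X_zero, zero_mul, coeff_C_zero]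
      nlinarith [hQr 0 (by omega)]
    | succ i =>
      simp only [coeff_sub, coeff_X_mul, coeff_C_mul]
      have h1 := hQr i (by omega)
      have h2 : 0 ≤ Q.coeff (i + 1) := by
        rcases Nat.lt_or_ge m (i + 1) with h | h
        · rw [coeff_eq_zero_of_natDegree_lt (by omega)]
        · exact (hQr _ h).le
      nlinarith

/-- If two polynomials are nonnegative on `(0, ∞)`, then the order of vanishing at `0` of their
sum is at most that of either of them. -/
theorem X_pow_dvd_of_dvd_add {b c : ℝ[X]} (hb : ∀ t, 0 < t → 0 ≤ b.eval t)
    (hc : ∀ t, 0 < t → 0 ≤ c.eval t) {m : ℕ} (h : X ^ m ∣ b + c) : X ^ m ∣ b := by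
  by_cases hb0 : b = 0
  · simp [hb0]
  obtain ⟨g, hg⟩ := h
  obtain ⟨u, hu, hu0⟩ := exists_eq_pow_rootMultiplicity_mul_and_not_dvd b hb0 0
  rw [C_0, sub_zero] at hu hu0
  set a := rootMultiplicity 0 b
  rcases le_or_gt m a with hma | hma
  · rw [hu]; exact (pow_dvd_pow X hma).mul_right u
  exfalso
  apply hu0
  rw [X_dvd_iff, coeff_zero_eq_eval_zero]
  obtain ⟨l, rfl⟩ := Nat.exists_eq_add_of_lt hma
  -- If `b` vanished only to order `a < m`, then `0 ≤ b ≤ b + c = O(t ^ (a + l + 1))`; dividing by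
  -- `t ^ a` and letting `t → 0⁺` forces `u 0 = 0`.
  have hle : ∀ t : ℝ, 0 < t → |u.eval t| ≤ t * (t ^ l * |g.eval t|) := by
    intro t ht
    have h1 : b.eval t + c.eval t = t ^ (a + l + 1) * g.eval t := by
      rw [← eval_add, hg]; simp
    have h2 : b.eval t = t ^ a * u.eval t := by
      conv_lhs => rw [hu]
      simp
    have h3 : |b.eval t| ≤ |b.eval t + c.eval t| := by
      rw [abs_of_nonneg (hb t ht), abs_of_nonneg (add_nonneg (hb t ht) (hc t ht))]
      linarith [hc t ht]
    rw [h1, h2, abs_mul, abs_mul, abs_of_pos (pow_pos ht _), abs_of_pos (pow_pos ht _)] at h3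
    have h4 : t ^ a * |u.eval t| ≤ t ^ a * (t * (t ^ l * |g.eval t|)) := by
      refine h3.trans (le_of_eq ?_); ring
    exact le_of_mul_le_mul_left h4 (pow_pos ht _)
  have hlim1 : Filter.Tendsto (fun t : ℝ => |u.eval t|) (nhdsWithin 0 (Set.Ioi 0))
      (nhds |u.eval 0|) :=
    ((u.continuous.abs).tendsto 0).mono_left nhdsWithin_le_nhds
  have hlim2 : Filter.Tendsto (fun t : ℝ => t * (t ^ l * |g.eval t|)) (nhdsWithin 0 (Set.Ioi 0))
      (nhds (0 * (0 ^ l * |g.eval 0|))) := by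
    have hcont : Continuous fun t : ℝ => t * (t ^ l * |g.eval t|) :=
      continuous_id.mul ((continuous_pow l).mul g.continuous.abs)
    exact (hcont.tendsto 0).mono_left nhdsWithin_le_nhds
  have := le_of_tendsto_of_tendsto hlim1 hlim2
    (Filter.eventually_of_mem self_mem_nhdsWithin fun t ht => hle t ht)
  rw [zero_mul] at this
  exact abs_eq_zero.1 (le_antisymm this (abs_nonneg _))

end RealRooted

/-! ### Moving roots across the real axis. -/

section Stability

variable {n : ℕ}

/-- Each root `z` has `Im z < 0`, so `|s - z| ≥ Im s`. The bound serves as a closed condition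
replacing the absence of roots. -/
theorem norm_eval_ge_of_roots_im_neg : ∀ (m : ℕ) (f : ℂ[X]), f.natDegree = m → f ≠ 0 →
    (∀ s : ℂ, 0 ≤ s.im → f.eval s ≠ 0) →
    ∀ s : ℂ, 0 ≤ s.im → ‖f.leadingCoeff‖ * s.im ^ m ≤ ‖f.eval s‖ := by
  intro m
  induction m with
  | zero =>
    intro f hf _ _ s _
    rw [eq_C_of_natDegree_eq_zero hf]; simp
  | succ m ih =>
    intro f hf hf0 hr s hs
    have hdeg : 0 < f.degree := natDegree_pos_iff_degree_pos.1 (by omega)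
    obtain ⟨z, hz⟩ := Complex.exists_root hdeg
    have him : z.im < 0 := by
      by_contra h
      exact hr z (not_lt.1 h) hz
    obtain ⟨g, hg⟩ := dvd_iff_isRoot.2 hz
    have hg0 : g ≠ 0 := by rintro rfl; simp [hf0] at hg
    have hgd : g.natDegree = m := by
      have := natDegree_mul (X_sub_C_ne_zero z) hg0
      rw [← hg, hf, natDegree_X_sub_C] at this
      omega
    have hgr := ih g hgd hg0 (fun w hw h => hr w hw (by rw [hg, eval_mul, h, mul_zero])) s hs
    rw [hg, leadingCoeff_mul, leadingCoeff_X_sub_C, one_mul, eval_mul, norm_mul, eval_sub, eval_X,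
      eval_C]
    have h1 : s.im ≤ ‖s - z‖ := by
      have := Complex.abs_im_le_norm (s - z)
      rw [Complex.sub_im] at this
      linarith [le_abs_self (s.im - z.im)]
    calc ‖g.leadingCoeff‖ * s.im ^ (m + 1) = s.im * (‖g.leadingCoeff‖ * s.im ^ m) := by ring
      _ ≤ ‖s - z‖ * ‖g.eval s‖ :=
        mul_le_mul h1 hgr (by positivity) (norm_nonneg _)

theorem continuous_aeval_comp {T : Type*} [TopologicalSpace T] (q : MvPolynomial (Fin n) ℝ)
    {w : T → Fin n → ℂ} (hw : Continuous w) : Continuous fun t => MvPolynomial.aeval (w t) q := by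
  have h : ∀ v : Fin n → ℂ, MvPolynomial.aeval v q
      = MvPolynomial.eval v (MvPolynomial.map (algebraMap ℝ ℂ) q) := fun v => by
    rw [MvPolynomial.eval_map, MvPolynomial.aeval_def]
  simp only [h]
  exact (MvPolynomial.continuous_eval _).comp hw

/-- Roots in `s` of `q (s y + w₀ + α w₁)` cannot move from the lower to the upper half-plane
without crossing the real axis. -/
theorem no_roots_upper_of_path {q : MvPolynomial (Fin n) ℝ} {d : ℕ} (hq : q.IsHomogeneous d)
    {y w₀ w₁ : Fin n → ℂ} (hy : MvPolynomial.aeval y q ≠ 0)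
    (hreal : ∀ α : ℝ, α ∈ Set.Icc (0 : ℝ) 1 → ∀ s : ℝ,
      MvPolynomial.aeval (fun i => w₀ i + α * w₁ i + s * y i) q ≠ 0)
    (h0 : ∀ s : ℂ, 0 ≤ s.im → MvPolynomial.aeval (fun i => w₀ i + s * y i) q ≠ 0)
    (s : ℂ) (hs : 0 ≤ s.im) : MvPolynomial.aeval (fun i => w₀ i + w₁ i + s * y i) q ≠ 0 := by
  set F : ℝ → ℂ → ℂ := fun α s => MvPolynomial.aeval (fun i => w₀ i + α * w₁ i + s * y i) q
    with hF
  -- Homogenized compactification of the closed upper half-plane: `(σ, u)` stands for `s = σ / u`,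
  -- and at `u = 0` the polynomial is `σ ^ d * q y ≠ 0`, so no root escapes to infinity.
  set K : Set (ℂ × ℝ) := {p | 0 ≤ p.1.im ∧ 0 ≤ p.2} ∩ Metric.sphere 0 1 with hK
  have hKc : IsCompact K := by
    refine (isCompact_sphere 0 1).inter_left ?_
    exact (isClosed_le continuous_const (Complex.continuous_im.comp continuous_fst)).inter
      (isClosed_le continuous_const continuous_snd)
  set G : ℝ × (ℂ × ℝ) → ℂ := fun p =>
    MvPolynomial.aeval (fun i => p.2.2 * (w₀ i + p.1 * w₁ i) + p.2.1 * y i) q with hG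
  have hGc : Continuous G := by
    apply continuous_aeval_comp
    fun_prop
  have hFG : ∀ (α : ℝ) (u : ℝ) (s : ℂ), G (α, (u * s, u)) = (u : ℂ) ^ d * F α s := by
    intro α u s
    rw [hF, ← aeval_mul_of_isHomogeneous hq]
    simp only [hG]
    congr 2
    ext i
    ring
  set bad : Set ℝ := Prod.fst '' ((Set.Icc (0 : ℝ) 1 ×ˢ K) ∩ {p | G p = 0}) with hbad
  have hbadc : IsClosed bad := by
    refine (IsCompact.image ?_ continuous_fst).isClosed
    exact (isCompact_Icc.prod hKc).inter_right (isClosed_eq hGc continuous_const)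
  set good : Set ℝ := {α | ∀ s : ℂ, 0 ≤ s.im →
    ‖MvPolynomial.aeval y q‖ * s.im ^ d ≤ ‖F α s‖} with hgood
  have hgoodc : IsClosed good := by
    simp only [hgood, Set.ofPred_forall]
    refine isClosed_iInter fun s => isClosed_iInter fun _ => isClosed_le continuous_const ?_
    refine Continuous.norm ?_
    apply continuous_aeval_comp
    fun_prop
  have hgood_iff : ∀ α ∈ Set.Icc (0 : ℝ) 1, α ∈ good ↔ ∀ s : ℂ, 0 ≤ s.im → F α s ≠ 0 := by
    intro α hα
    constructor
    · intro h s hs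
      rcases hs.eq_or_lt with h' | h'
      · have : s = (s.re : ℂ) := by apply Complex.ext <;> simp [← h']
        rw [this]; exact hreal α hα s.re
      · intro h2
        have h1 := h s hs
        rw [h2, norm_zero] at h1
        have : 0 < ‖MvPolynomial.aeval y q‖ * s.im ^ d := by positivity
        linarith
    · intro h s hs
      have hpd := pencil_degree hq (fun i => w₀ i + α * w₁ i) y
      have hdeg : (pencil q (fun i => w₀ i + α * w₁ i) y).natDegree = d :=
        le_antisymm hpd.1 (le_natDegree_of_ne_zero (by rw [hpd.2]; exact hy))
      have hlead : (pencil q (fun i => w₀ i + α * w₁ i) y).leadingCoeff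
          = MvPolynomial.aeval y q := by rw [leadingCoeff, hdeg, hpd.2]
      have := norm_eval_ge_of_roots_im_neg d _ hdeg
        (by intro h0; rw [h0, leadingCoeff_zero] at hlead; exact hy hlead.symm)
        (fun s hs => by rw [eval_pencil]; exact h s hs) s hs
      rwa [hlead, eval_pencil] at this
  have hbad_iff : ∀ α ∈ Set.Icc (0 : ℝ) 1, α ∈ bad ↔ ∃ s : ℂ, 0 ≤ s.im ∧ F α s = 0 := by
    intro α hα
    constructor
    · rintro ⟨⟨β, σ, u⟩, ⟨⟨-, ⟨hσ, hu⟩, hn⟩, hz⟩, rfl⟩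
      simp only at hσ hu
      have hz : G (β, (σ, u)) = 0 := hz
      rcases hu.eq_or_lt with h | h
      · exfalso
        have h1 : G (β, (σ, u)) = σ ^ d * MvPolynomial.aeval y q := by
          rw [← aeval_mul_of_isHomogeneous hq]
          simp [hG, ← h]
        rw [h1] at hz
        have hσ0 : σ ≠ 0 := by
          rintro rfl
          rw [← h] at hn
          simp at hn
        exact mul_ne_zero (pow_ne_zero _ hσ0) hy hz
      · have hu0 : (u : ℂ) ≠ 0 := by exact_mod_cast h.ne'
        refine ⟨σ / u, ?_, ?_⟩
        · rw [Complex.div_ofReal_im]; positivity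
        · have h1 := hFG β u (σ / u)
          rw [mul_div_cancel₀ _ hu0, hz] at h1
          exact (mul_eq_zero.1 h1.symm).resolve_left (pow_ne_zero _ hu0)
    · rintro ⟨s, hs, hz⟩
      have hm : 0 < max ‖s‖ 1 := lt_max_of_lt_right one_pos
      refine ⟨(α, (((max ‖s‖ 1)⁻¹ : ℝ) * s, (max ‖s‖ 1)⁻¹)), ⟨⟨hα, ⟨?_, ?_⟩, ?_⟩, ?_⟩, rfl⟩
      · simp only [Complex.im_ofReal_mul]; positivity
      · simp only; positivity
      · rw [mem_sphere_zero_iff_norm, Prod.norm_def]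
        simp only [norm_mul, Complex.norm_real, Real.norm_eq_abs, abs_of_pos (inv_pos.2 hm)]
        have h1 : max ((max ‖s‖ 1)⁻¹ * ‖s‖) (max ‖s‖ 1)⁻¹ = (max ‖s‖ 1)⁻¹ * max ‖s‖ 1 := by
          rw [mul_max_of_nonneg _ _ (inv_nonneg.2 hm.le), mul_one]
        rw [h1, inv_mul_cancel₀ hm.ne']
      · rw [Set.mem_ofPred_eq, hFG, hz, mul_zero]
  -- `good` and `bad` are closed, cover `[0, 1]` and are disjoint there; since `0` is good,
  -- connectedness excludes that `1` is bad.
  have hconn := isPreconnected_closed_iff.1 (isPreconnected_Icc (a := (0 : ℝ)) (b := 1)) good bad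
    hgoodc hbadc (fun α hα => by
      by_cases h : α ∈ good
      · exact Or.inl h
      · right
        rw [hgood_iff α hα] at h
        push Not at h
        exact (hbad_iff α hα).2 h)
    ⟨0, by simp, (hgood_iff 0 (by simp)).2 fun s hs => by simpa [hF] using h0 s hs⟩
  intro hzero
  obtain ⟨α, hα, hg, hb⟩ := hconn ⟨1, by simp, (hbad_iff 1 (by simp)).2
    ⟨s, hs, by simpa [hF] using hzero⟩⟩
  obtain ⟨s', hs', hz'⟩ := (hbad_iff α hα).1 hb
  exact (hgood_iff α hα).1 hg s' hs' hz'

end Stability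

/-! ### Gårding's theory: convexity of the cone, nullity and faces. -/

section Garding

variable {n : ℕ}

/-- A homogeneous polynomial of degree `d`, positive at `e`, without zeros on `x + z e` for real
`x` and nonreal `z`. -/
structure IsHyperbolicOfDegree (q : MvPolynomial (Fin n) ℝ) (d : ℕ) (e : Fin n → ℝ) : Prop where
  homogeneous : q.IsHomogeneous d
  pos : 0 < MvPolynomial.aeval e q
  ne_zero : ∀ (x : Fin n → ℝ) (z : ℂ), z.im ≠ 0 →
    MvPolynomial.aeval (fun i => (x i : ℂ) + z * e i) q ≠ 0

/-- The vectors `x` such that `q` has no zero on the ray `x + t e`, `t > 0`. -/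
def closedCone (q : MvPolynomial (Fin n) ℝ) (e : Fin n → ℝ) : Set (Fin n → ℝ) :=
  {x | ∀ t : ℝ, 0 < t → MvPolynomial.aeval (fun i => x i + t * e i) q ≠ 0}

/-- The vectors `x` such that `q` has no zero on the ray `x + t e`, `t ≥ 0`. -/
def openCone (q : MvPolynomial (Fin n) ℝ) (e : Fin n → ℝ) : Set (Fin n → ℝ) :=
  {x | ∀ t : ℝ, 0 ≤ t → MvPolynomial.aeval (fun i => x i + t * e i) q ≠ 0}

theorem aeval_ofReal (q : MvPolynomial (Fin n) ℝ) (w : Fin n → ℝ) :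
    MvPolynomial.aeval (fun i => (w i : ℂ)) q = ((MvPolynomial.aeval w q : ℝ) : ℂ) := by
  have h := MvPolynomial.comp_aeval (R := ℝ) w (Algebra.ofId ℝ ℂ)
  have h2 := congrArg (fun φ => φ q) h
  exact h2.symm

/-- Shows that coefficients of a pencil depend polynomially on a parameter, for limits, continuity
and orders of vanishing. -/
theorem eval_coeff_pencil (q : MvPolynomial (Fin n) ℝ) (a b : Fin n → ℝ[X]) (t : ℝ) (j : ℕ) :
    ((pencil q a b).coeff j).eval t
      = (pencil q (fun i => (a i).eval t) (fun i => (b i).eval t)).coeff j := by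
  have h := coeff_pencil_map q a b (aeval t) j
  simpa only [coe_aeval_eq_eval] using h

theorem add_mem_openCone {q : MvPolynomial (Fin n) ℝ} {e x : Fin n → ℝ} (hx : x ∈ closedCone q e)
    {t : ℝ} (ht : 0 < t) : (fun i => x i + t * e i) ∈ openCone q e := by
  intro s hs
  have := hx (t + s) (by linarith)
  simpa only [add_mul, add_assoc] using this

namespace IsHyperbolicOfDegree

variable {q : MvPolynomial (Fin n) ℝ} {d : ℕ} {e x y : Fin n → ℝ}

theorem aeval_pencil_ofReal (q : MvPolynomial (Fin n) ℝ) (a b : Fin n → ℝ) (z : ℂ) :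
    aeval z (pencil q a b) = MvPolynomial.aeval (fun i => (a i : ℂ) + z * b i) q :=
  aeval_pencil q a b z

theorem leadingCoeff_pencil (hq : IsHyperbolicOfDegree q d e) (a : Fin n → ℝ) {y : Fin n → ℝ}
    (hy : 0 < MvPolynomial.aeval y q) :
    (pencil q a y).natDegree = d ∧ 0 < (pencil q a y).leadingCoeff := by
  have h := pencil_degree hq.homogeneous a y
  have hdeg : (pencil q a y).natDegree = d :=
    le_antisymm h.1 (le_natDegree_of_ne_zero (by rw [h.2]; exact hy.ne'))
  exact ⟨hdeg, by rw [leadingCoeff, hdeg, h.2]; exact hy⟩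

theorem im_eq_zero_of_root (hq : IsHyperbolicOfDegree q d e) {z : ℂ}
    (hz : aeval z (pencil q x e) = 0) : z.im = 0 ∧
      MvPolynomial.aeval (fun i => x i + z.re * e i) q = 0 := by
  rw [aeval_pencil_ofReal] at hz
  have him : z.im = 0 := by
    by_contra h
    exact hq.ne_zero x z h hz
  refine ⟨him, ?_⟩
  have hzr : z = (z.re : ℂ) := by apply Complex.ext <;> simp [him]
  rw [hzr] at hz
  have h := aeval_ofReal q (fun i => x i + z.re * e i)
  push_cast at h
  rw [hz] at h
  exact_mod_cast h.symm

theorem coeff_pencil_pos (hq : IsHyperbolicOfDegree q d e) (hx : x ∈ openCone q e) :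
    ∀ i ≤ d, 0 < (pencil q x e).coeff i := by
  have h := hq.leadingCoeff_pencil x hq.pos
  refine coeff_pos_of_roots_neg d _ h.1 h.2 fun z hz => ?_
  obtain ⟨him, hz'⟩ := hq.im_eq_zero_of_root hz
  exact ⟨him, by_contra fun hre => hx z.re (not_lt.1 hre) hz'⟩

theorem aeval_pos (hq : IsHyperbolicOfDegree q d e) (hx : x ∈ openCone q e) :
    0 < MvPolynomial.aeval x q := by
  have h := hq.coeff_pencil_pos hx 0 (Nat.zero_le _)
  rw [coeff_zero_eq_eval_zero, eval_pencil] at h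
  simpa using h

/-- Deform `x` to `0`. Along the path real `s` is excluded by hyperbolicity; at the end `t / s`
would be a negative real, against `Im t > 0` and `Im s ≥ 0`. -/
theorem ne_zero_of_im (hq : IsHyperbolicOfDegree q d e) (hy : y ∈ openCone q e) (x : Fin n → ℝ)
    {t s : ℂ} (ht : 0 < t.im) (hs : 0 ≤ s.im) :
    MvPolynomial.aeval (fun i => t * e i + x i + s * y i) q ≠ 0 := by
  refine no_roots_upper_of_path hq.homogeneous ?_ ?_ ?_ s hs
  · rw [aeval_ofReal]; exact_mod_cast (hq.aeval_pos hy).ne'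
  · intro α _ s
    have := hq.ne_zero (fun i => α * x i + s * y i) t ht.ne'
    convert this using 3
    push_cast; ring_nf
  · intro s hs
    by_cases hs0 : s = 0
    · subst hs0
      simp only [zero_mul, add_zero]
      rw [aeval_mul_of_isHomogeneous hq.homogeneous, aeval_ofReal]
      refine mul_ne_zero (pow_ne_zero _ ?_) (by exact_mod_cast hq.pos.ne')
      rintro rfl; simp at ht
    · have h1 : (fun i => t * (e i : ℂ) + s * y i) = fun i => s * ((y i : ℂ) + t / s * e i) := by
        ext i; field_simp; ring
      rw [h1, aeval_mul_of_isHomogeneous hq.homogeneous]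
      refine mul_ne_zero (pow_ne_zero _ hs0) fun hz => ?_
      rw [← aeval_pencil_ofReal] at hz
      obtain ⟨him, hz'⟩ := hq.im_eq_zero_of_root hz
      have hr : (t / s).re < 0 := by_contra fun hre => hy _ (not_lt.1 hre) hz'
      have hzr : t / s = ((t / s).re : ℂ) := by apply Complex.ext <;> simp [him]
      have h2 : t = ((t / s).re : ℂ) * s := by rw [← hzr, div_mul_cancel₀ _ hs0]
      have h3 := congrArg Complex.im h2
      rw [Complex.im_ofReal_mul] at h3
      nlinarith

/-- The same deformation, now shrinking `r x`; `ne_zero_of_im` for `x` excludes real `s`. -/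
theorem ne_zero_of_im_of_im (hq : IsHyperbolicOfDegree q d e) (hx : x ∈ openCone q e)
    (hy : y ∈ openCone q e) {t r s : ℂ} (ht : 0 < t.im) (hr : 0 ≤ r.im) (hs : 0 ≤ s.im) :
    MvPolynomial.aeval (fun i => t * e i + r * x i + s * y i) q ≠ 0 := by
  refine no_roots_upper_of_path hq.homogeneous ?_ ?_ ?_ s hs
  · rw [aeval_ofReal]; exact_mod_cast (hq.aeval_pos hy).ne'
  · intro α hα s
    have := hq.ne_zero_of_im hx (fun i => s * y i) (s := α * r) ht
      (by rw [Complex.im_ofReal_mul]; exact mul_nonneg hα.1 hr)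
    convert this using 3
    push_cast; ring_nf
  · intro s hs
    simpa using hq.ne_zero_of_im hy 0 ht hs

theorem ne_zero_of_not_neg (hq : IsHyperbolicOfDegree q d e) (hx : x ∈ openCone q e)
    (hy : y ∈ openCone q e) {t : ℝ} (ht : 0 < t) {z : ℂ} (hz : ¬ (z.im = 0 ∧ z.re < 0)) :
    MvPolynomial.aeval (fun i => ((x i + t * e i : ℝ) : ℂ) + z * y i) q ≠ 0 := by
  -- As `z` is not a negative real, a rotation `ω` puts `1` in the open and `z` in the closed upper
  -- half-plane; homogeneity absorbs `ω`.
  obtain ⟨ω, hω, hωz⟩ : ∃ ω : ℂ, 0 < ω.im ∧ 0 ≤ (ω * z).im := by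
    rcases lt_trichotomy z.im 0 with h | h | h
    · exact ⟨⟨z.re, -z.im⟩, by simpa using h, by simp; nlinarith⟩
    · exact ⟨Complex.I, by simp, by simpa [h] using hz⟩
    · exact ⟨⟨-z.re, z.im⟩, by simpa using h, by simp; nlinarith⟩
  intro h0
  refine hq.ne_zero_of_im_of_im hx hy (t := t * ω) (r := ω) (s := ω * z)
    (by rw [Complex.im_ofReal_mul]; positivity) hω.le hωz ?_
  have h1 : (fun i => (t * ω) * (e i : ℂ) + ω * x i + ω * z * y i)
      = fun i => ω * (((x i + t * e i : ℝ) : ℂ) + z * y i) := by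
    ext i; push_cast; ring
  rw [h1, aeval_mul_of_isHomogeneous hq.homogeneous, h0, mul_zero]

theorem coeff_pencil_nonneg_of_openCone (hq : IsHyperbolicOfDegree q d e)
    (hx : x ∈ openCone q e) (hy : y ∈ openCone q e) {t : ℝ} (ht : 0 < t) (j : ℕ) :
    0 ≤ (pencil q (fun i => x i + t * e i) y).coeff j := by
  have h := hq.leadingCoeff_pencil (fun i => x i + t * e i) (hq.aeval_pos hy)
  rcases le_or_gt j d with hj | hj
  · refine (coeff_pos_of_roots_neg d _ h.1 h.2 (fun z hz => ?_) j hj).le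
    rw [aeval_pencil_ofReal] at hz
    exact by_contra fun hn => hq.ne_zero_of_not_neg hx hy ht hn hz
  · rw [coeff_eq_zero_of_natDegree_lt (by omega)]

theorem coeff_pencil_nonneg (hq : IsHyperbolicOfDegree q d e)
    (hx : x ∈ closedCone q e) (hy : y ∈ closedCone q e) {t : ℝ} (ht : 0 < t) (j : ℕ) :
    0 ≤ (pencil q (fun i => x i + t * e i) y).coeff j := by
  -- Perturb `y` to `y + δ e` and spend half of `t e` to move `x` into the open cone; then let `δ →
  -- 0⁺`.
  set D : ℝ[X] := (pencil q (fun i => C (x i + t * e i)) (fun i => C (y i) + X * C (e i))).coeff j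
    with hD
  have hev : ∀ δ : ℝ, D.eval δ
      = (pencil q (fun i => x i + t * e i) (fun i => y i + δ * e i)).coeff j := by
    intro δ
    rw [hD, eval_coeff_pencil]
    simp only [eval_add, eval_mul, eval_C, eval_X]
  have hpos : ∀ δ : ℝ, 0 < δ → 0 ≤ D.eval δ := by
    intro δ hδ
    rw [hev]
    have h := hq.coeff_pencil_nonneg_of_openCone (add_mem_openCone hx (half_pos ht))
      (add_mem_openCone hy hδ) (half_pos ht) j
    convert h using 4
    ring
  have h0 : 0 ≤ D.eval 0 :=
    ge_of_tendsto ((D.continuous.tendsto 0).mono_left (nhdsWithin_le_nhds (s := Set.Ioi 0)))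
      (Filter.eventually_of_mem self_mem_nhdsWithin fun δ hδ => hpos δ hδ)
  rw [hev] at h0
  simpa using h0

/-- The cone of a hyperbolic polynomial is closed under addition. -/
theorem add_mem (hq : IsHyperbolicOfDegree q d e)
    (hx : x ∈ closedCone q e) (hy : y ∈ closedCone q e) : x + y ∈ closedCone q e := by
  intro t ht
  have h1 : MvPolynomial.aeval (fun i => (x + y) i + t * e i) q
      = (pencil q (fun i => x i + t * e i) y).eval 1 := by
    rw [eval_pencil]
    congr 2; ext i; simp only [Pi.add_apply]; ring
  have h2 : 0 < (pencil q (fun i => x i + t * e i) y).coeff 0 := by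
    rw [coeff_zero_eq_eval_zero, eval_pencil]
    simpa using hq.aeval_pos (add_mem_openCone hx ht)
  rw [h1, eval_eq_sum_range]
  refine (lt_of_lt_of_le h2 ?_).ne'
  have := Finset.single_le_sum (f := fun j => (pencil q (fun i => x i + t * e i) y).coeff j * 1 ^ j)
    (fun j _ => by simpa using hq.coeff_pencil_nonneg hx hy ht j)
    (Finset.mem_range.2 (Nat.succ_pos (pencil q (fun i => x i + t * e i) y).natDegree))
  simpa using this

/-- If `q (x + y + T e)` vanishes to order `m` at `T = 0`, so does `q (x + s y + T e)` for
every `s`. -/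
theorem X_pow_dvd_pencil (hq : IsHyperbolicOfDegree q d e)
    (hx : x ∈ closedCone q e) (hy : y ∈ closedCone q e) {m : ℕ}
    (h : X ^ m ∣ pencil q (x + y) e) (s : ℝ) : X ^ m ∣ pencil q (fun i => x i + s * y i) e := by
  -- A polynomial in `s` over polynomials in `T`. Its coefficients are nonnegative for `T > 0`, so
  -- nothing cancels at `s = 1`: divisibility of the sum by `X ^ m` passes to each coefficient.
  set B : ℝ[X][X] := pencil q (fun i => C (x i) + X * C (e i)) (fun i => C (y i)) with hB
  have hev : ∀ s : ℝ, B.eval (C s) = pencil q (fun i => x i + s * y i) e := by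
    intro s
    rw [hB, eval_pencil, pencil]
    congr 2; ext1 i; simp only [map_add, map_mul]; ring
  have hcoeff : ∀ (j : ℕ) (t : ℝ), 0 < t → 0 ≤ (B.coeff j).eval t := by
    intro j t ht
    have h2 : (B.coeff j).eval t = (pencil q (fun i => x i + t * e i) y).coeff j := by
      rw [hB, eval_coeff_pencil]
      simp only [eval_add, eval_mul, eval_C, eval_X]
    rw [h2]
    exact hq.coeff_pencil_nonneg hx hy ht j
  have hsum : X ^ m ∣ ∑ j ∈ range (B.natDegree + 1), B.coeff j := by
    have h1 := hev 1
    rw [eval_eq_sum_range] at h1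
    simp only [map_one, one_pow, mul_one, one_mul] at h1
    rw [h1]; exact h
  rw [← hev s, eval_eq_sum_range]
  refine Finset.dvd_sum fun j hj => Dvd.dvd.mul_right ?_ _
  rw [← Finset.add_sum_erase _ _ hj] at hsum
  refine X_pow_dvd_of_dvd_add (hcoeff j) (fun t ht => ?_) hsum
  rw [eval_finsetSum]
  exact Finset.sum_nonneg fun i _ => hcoeff i t ht

/-- The multiplicity of the eigenvalue `0` of `x`. -/
noncomputable def nullity (q : MvPolynomial (Fin n) ℝ) (e x : Fin n → ℝ) : ℕ :=
  (pencil q x e).natTrailingDegree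

theorem pencil_ne_zero (hq : IsHyperbolicOfDegree q d e) (x : Fin n → ℝ) : pencil q x e ≠ 0 := by
  intro h
  have := (hq.leadingCoeff_pencil x hq.pos).2
  simp [h] at this

theorem nullity_le (hq : IsHyperbolicOfDegree q d e) (x : Fin n → ℝ) : nullity q e x ≤ d :=
  (natTrailingDegree_le_natDegree _).trans_eq (hq.leadingCoeff_pencil x hq.pos).1

theorem X_pow_nullity_dvd (q : MvPolynomial (Fin n) ℝ) (e x : Fin n → ℝ) :
    X ^ nullity q e x ∣ pencil q x e :=
  X_pow_dvd_iff.2 fun _ h => coeff_eq_zero_of_lt_natTrailingDegree h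

theorem nullity_add_le (hq : IsHyperbolicOfDegree q d e)
    (hx : x ∈ closedCone q e) (hy : y ∈ closedCone q e) :
    nullity q e (x + y) ≤ nullity q e x := by
  have h := hq.X_pow_dvd_pencil hx hy (X_pow_nullity_dvd q e (x + y)) 0
  simp only [zero_mul, add_zero] at h
  by_contra hlt
  have h1 := X_pow_dvd_iff.1 h _ (not_le.1 hlt)
  exact hq.pencil_ne_zero x (trailingCoeff_eq_zero.1 h1)

/-- Once the power of `X` is divided out, only negative roots remain. -/
theorem coeff_pencil_pos_of_nullity_le (hq : IsHyperbolicOfDegree q d e)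
    (hx : x ∈ closedCone q e) {j : ℕ} (hj : nullity q e x ≤ j) (hjd : j ≤ d) :
    0 < (pencil q x e).coeff j := by
  obtain ⟨g, hg⟩ := X_pow_nullity_dvd q e x
  set m := nullity q e x with hm
  have h := hq.leadingCoeff_pencil x hq.pos
  have hg0 : g ≠ 0 := by
    rintro rfl
    exact hq.pencil_ne_zero x (by simpa using hg)
  have hgd : m + g.natDegree = d := by
    rw [← h.1, hg, natDegree_mul (pow_ne_zero _ X_ne_zero) hg0, natDegree_X_pow]
  have hgl : 0 < g.leadingCoeff := by
    have := h.2
    rwa [hg, leadingCoeff_mul, leadingCoeff_X_pow, one_mul] at this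
  have hgc : g.coeff 0 ≠ 0 := by
    have h1 : (pencil q x e).coeff m ≠ 0 := by
      intro h1
      exact hq.pencil_ne_zero x (trailingCoeff_eq_zero.1 h1)
    rw [hg, coeff_X_pow_mul'] at h1
    simpa using h1
  have hpos := coeff_pos_of_roots_neg g.natDegree g rfl hgl fun z hz => by
    have hz' : aeval z (pencil q x e) = 0 := by rw [hg, map_mul, hz, mul_zero]
    obtain ⟨him, hre⟩ := hq.im_eq_zero_of_root hz'
    refine ⟨him, ?_⟩
    rcases lt_trichotomy z.re 0 with h | h | h
    · exact h
    · exfalso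
      have : z = 0 := by apply Complex.ext <;> simp [h, him]
      rw [this, ← coeff_zero_eq_aeval_zero'] at hz
      exact hgc (by simpa using hz)
    · exact absurd hre (hx _ h)
  rw [hg, coeff_X_pow_mul', if_pos hj]
  exact hpos _ (by omega)

/-- If adding `y` does not lower the nullity of `x`, then `y` lies in the face of `x`. -/
theorem eventually_sub_mem (hq : IsHyperbolicOfDegree q d e)
    (hx : x ∈ closedCone q e) (hy : y ∈ closedCone q e)
    (h : nullity q e x ≤ nullity q e (x + y)) :
    ∀ᶠ ε in nhdsWithin (0 : ℝ) (Set.Ioi 0), x - ε • y ∈ closedCone q e := by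
  -- Coefficients below the nullity vanish for every `s`. The others are positive at `s = 0`, hence
  -- also at `s = -ε`, so no zero occurs at `t > 0`.
  have hdvd := hq.X_pow_dvd_pencil hx hy ((pow_dvd_pow X h).trans (X_pow_nullity_dvd q e (x + y)))
  have hcont : ∀ j, Continuous fun s : ℝ => (pencil q (fun i => x i + s * y i) e).coeff j := by
    intro j
    have h1 : ∀ s : ℝ, (pencil q (fun i => x i + s * y i) e).coeff j
        = ((pencil q (fun i => C (x i) + X * C (y i)) (fun i => C (e i))).coeff j).eval s := by
      intro s
      rw [eval_coeff_pencil]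
      simp only [eval_add, eval_mul, eval_C, eval_X]
    simp only [h1]
    exact Polynomial.continuous _
  have hev : ∀ᶠ s in nhds (0 : ℝ), ∀ j ∈ Finset.Icc (nullity q e x) d,
      0 < (pencil q (fun i => x i + s * y i) e).coeff j := by
    rw [Filter.eventually_all_finset]
    intro j hj
    rw [Finset.mem_Icc] at hj
    refine (hcont j).continuousAt.eventually (lt_mem_nhds ?_)
    simpa using hq.coeff_pencil_pos_of_nullity_le hx hj.1 hj.2
  obtain ⟨ε₀, hε₀, hball⟩ := Metric.eventually_nhds_iff.1 hev
  filter_upwards [Ioo_mem_nhdsGT hε₀] with ε hε t ht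
  have hc := @hball (-ε) (by simpa [abs_of_pos hε.1] using hε.2)
  have h1 : MvPolynomial.aeval (fun i => (x - ε • y) i + t * e i) q
      = (pencil q (fun i => x i + -ε * y i) e).eval t := by
    rw [eval_pencil]
    congr 2; ext i; simp only [Pi.sub_apply, Pi.smul_apply, smul_eq_mul]; ring
  have hdeg := (hq.leadingCoeff_pencil (fun i => x i + -ε * y i) hq.pos).1
  rw [h1, eval_eq_sum_range, hdeg]
  refine (Finset.sum_pos' (fun j hj => ?_) ⟨d, by simp, ?_⟩).ne'
  · rcases lt_or_ge j (nullity q e x) with hj' | hj'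
    · rw [X_pow_dvd_iff.1 (hdvd (-ε)) j hj', zero_mul]
    · have := hc j (Finset.mem_Icc.2 ⟨hj', by simpa [Nat.lt_succ_iff] using hj⟩)
      positivity
  · have := hc d (Finset.mem_Icc.2 ⟨hq.nullity_le x, le_rfl⟩)
    positivity

end IsHyperbolicOfDegree

end Garding

/-! ### The combinatorial pigeonhole argument. -/

section Closure

/-- Finitely many closure operators with ranks on a large set: some `k`-element subset `S` has,
for each operator, either rank at least `k` or all of a large set `A` in its closure. -/
theorem exists_card_eq_forall_closure_or_rank_le {α ι : Type*} [DecidableEq α] [Fintype ι]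
    (cl : ι → Finset α → Set α) (rk : ι → Finset α → ℕ)
    (hmono : ∀ i S w, cl i S ⊆ cl i (insert w S))
    (hrk : ∀ i S u, u ∉ S → u ∉ cl i S → rk i S < rk i (insert u S)) (k N : ℕ) :
    ∃ M : ℕ, ∀ V : Finset α, M ≤ V.card → ∃ S ⊆ V, ∃ A ⊆ V, Disjoint S A ∧ S.card = k ∧
      N ≤ A.card ∧ ∀ i, (A : Set α) ⊆ cl i S ∨ k ≤ rk i S := by
  classical
  induction k generalizing N with
  | zero => exact ⟨N, fun V hV => ⟨∅, by simp, V, subset_rfl, by simp, rfl, hV, by simp⟩⟩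
  | succ k ih =>
    obtain ⟨M, hM⟩ := ih (Fintype.card (Finset ι) * (N + 1))
    refine ⟨M, fun V hV => ?_⟩
    obtain ⟨S, hS, A, hA, hdisj, hcard, hN, hSA⟩ := hM V hV
    obtain ⟨I, -, hI⟩ := Finset.exists_le_card_fiber_of_mul_le_card_of_maps_to (s := A)
      (t := (Finset.univ : Finset (Finset ι))) (f := fun u => Finset.univ.filter fun i => u ∈ cl i S)
      (fun _ _ => Finset.mem_univ _) Finset.univ_nonempty (by simpa using hN)
    set A' := A.filter fun u => (Finset.univ.filter fun i => u ∈ cl i S) = I with hA'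
    have hfib : ∀ u ∈ A', ∀ i, u ∈ cl i S ↔ i ∈ I := by
      intro u hu i
      rw [← (Finset.mem_filter.1 hu).2]; simp
    obtain ⟨u, hu⟩ : A'.Nonempty := Finset.card_pos.1 (by omega)
    have huA : u ∈ A := (Finset.mem_filter.1 hu).1
    have huS : u ∉ S := Finset.disjoint_right.1 hdisj huA
    refine ⟨insert u S, Finset.insert_subset (hA huA) hS, A'.erase u,
      ((Finset.erase_subset _ _).trans (Finset.filter_subset _ _)).trans hA, ?_, ?_, ?_, ?_⟩
    · rw [Finset.disjoint_insert_left]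
      exact ⟨Finset.notMem_erase _ _, hdisj.mono_right
        ((Finset.erase_subset _ _).trans (Finset.filter_subset _ _))⟩
    · rw [Finset.card_insert_of_notMem huS, hcard]
    · rw [Finset.card_erase_of_mem hu]; omega
    · intro i
      by_cases hi : i ∈ I
      · left
        intro w hw
        exact hmono i S u ((hfib w (Finset.mem_of_mem_erase hw) i).2 hi)
      · right
        have hucl : u ∉ cl i S := fun h => hi ((hfib u hu i).1 h)
        have hk : k ≤ rk i S := (hSA i).resolve_left fun h => hucl (h huA)
        exact Nat.succ_le_of_lt (hk.trans_lt (hrk i S u huS hucl))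

end Closure

section Lift

variable {n : ℕ}

theorem zero_mem_closedCone {p : MvPolynomial (Fin n) ℝ} {e : Fin n → ℝ} (hp : IsHyperbolic p e) :
    (0 : Fin n → ℝ) ∈ closedCone p e := by
  obtain ⟨d, hd⟩ := hp.homogeneous
  intro t ht
  have h := aeval_mul_of_isHomogeneous hd t e
  simp only [Pi.zero_apply, zero_add]
  rw [h]
  refine mul_ne_zero (pow_ne_zero _ ht.ne') ?_
  rw [MvPolynomial.aeval_eq_eval]
  exact hp.pos.ne'

theorem charPoly_eq_pencil (p : MvPolynomial (Fin n) ℝ) (e x : Fin n → ℝ) :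
    charPoly p e x = pencil p (-x) e := by
  rw [charPoly, pencil]
  congr 2
  ext1 i
  rw [Pi.neg_apply, map_neg]
  ring

theorem hyperbolicityCone_eq {p : MvPolynomial (Fin n) ℝ} {e : Fin n → ℝ}
    (hp : IsHyperbolic p e) : hyperbolicityCone p e = closedCone p e := by
  obtain ⟨d, hd⟩ := hp.homogeneous
  have hneg : ∀ (x : Fin n → ℝ) (t : ℝ), (charPoly p e x).IsRoot t ↔
      MvPolynomial.aeval (fun i => x i + -t * e i) p = 0 := by
    intro x t
    have h := aeval_mul_of_isHomogeneous hd (-1) (fun i => x i + -t * e i)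
    rw [charPoly_eq_pencil, IsRoot, eval_pencil]
    have h2 : (fun i => (-x) i + t * e i) = fun i => -1 * (x i + -t * e i) := by
      ext i; rw [Pi.neg_apply]; ring
    rw [h2, h]
    simp
  ext x
  constructor
  · intro hx t ht h
    have := hx (-t) ((hneg x _).2 (by simpa using h))
    linarith
  · intro hx t ht
    by_contra hlt
    exact hx (-t) (by linarith) ((hneg x t).1 ht)

theorem IsHyperbolic.exists_factor {p : MvPolynomial (Fin n) ℝ} {e : Fin n → ℝ}
    (hp : IsHyperbolic p e) {k : ℕ}
    (hdeg : ∀ q : MvPolynomial (Fin n) ℝ, Irreducible q → q ∣ p → q.totalDegree ≤ k)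
    {q : MvPolynomial (Fin n) ℝ} (hq : Irreducible q) (hqp : q ∣ p) :
    ∃ r d, d ≤ k ∧ IsHyperbolicOfDegree r d e ∧ closedCone r e = closedCone q e := by
  obtain ⟨D, hD⟩ := hp.homogeneous
  have hp0 : p ≠ 0 := by rintro rfl; simpa using hp.pos
  obtain ⟨d, hd⟩ := exists_isHomogeneous_of_dvd hD hp0 hqp
  have hqe : MvPolynomial.aeval e q ≠ 0 := by
    obtain ⟨s, rfl⟩ := hqp
    have := hp.pos.ne'
    rw [map_mul] at this
    rw [MvPolynomial.aeval_eq_eval]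
    exact left_ne_zero_of_mul this
  refine ⟨MvPolynomial.C (MvPolynomial.aeval e q) * q, d, ?_, ⟨hd.C_mul _, ?_, ?_⟩, ?_⟩
  · rw [← hd.totalDegree hq.ne_zero]
    exact hdeg q hq hqp
  · rw [map_mul, MvPolynomial.aeval_C]
    exact mul_self_pos.2 hqe
  · intro x z hz h
    rw [map_mul, MvPolynomial.aeval_C] at h
    have h0 := (mul_eq_zero.1 h).resolve_left (by simpa using hqe)
    refine hz (hp.realRooted (-x) z ?_)
    obtain ⟨s, rfl⟩ := hqp
    rw [charPoly_eq_pencil, neg_neg, IsHyperbolicOfDegree.aeval_pencil_ofReal, map_mul, h0,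
      zero_mul]
  · ext x
    simp only [closedCone, Set.mem_ofPred_eq, map_mul, MvPolynomial.aeval_C, ne_eq, mul_eq_zero]
    simp only [Algebra.algebraMap_self, RingHom.id_apply, hqe, false_or]

theorem mem_closedCone_iff_factors {p : MvPolynomial (Fin n) ℝ} (hp : p ≠ 0) (e x : Fin n → ℝ) :
    x ∈ closedCone p e ↔
      ∀ q ∈ UniqueFactorizationMonoid.factors p, x ∈ closedCone q e := by
  have h : ∀ v : Fin n → ℝ, MvPolynomial.aeval v p = 0 ↔
      ∃ q ∈ UniqueFactorizationMonoid.factors p, MvPolynomial.aeval v q = 0 := by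
    intro v
    obtain ⟨u, hu⟩ := UniqueFactorizationMonoid.factors_prod hp
    have hunit : MvPolynomial.aeval v (u : MvPolynomial (Fin n) ℝ) ≠ 0 :=
      (u.isUnit.map (MvPolynomial.aeval (R := ℝ) v)).ne_zero
    conv_lhs => rw [← hu]
    rw [map_mul, mul_eq_zero, or_iff_left hunit, map_multiset_prod, Multiset.prod_eq_zero_iff,
      Multiset.mem_map]
  simp only [closedCone, Set.mem_ofPred_eq, ne_eq, h, not_exists, not_and]
  exact ⟨fun H q hq t ht => H t ht q hq, fun H t ht q hq => H q hq t ht⟩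

end Lift

end ConeLift

theorem corollary2p3 {E : Type*} [NormedAddCommGroup E] [InnerProductSpace ℝ E]
    [FiniteDimensional ℝ E] (k : ℕ) (C : ConvexCone ℝ E) (hC : ConeLift.IsProper C)
    (hV : ∀ N : ℕ, ∃ V : Set E, V ⊆ ConeLift.normalizedExtremeRays C ∧
      (N : ℕ∞) ≤ V.encard ∧ ConeLift.IsNeighborly k C V)
    {n : ℕ} (p : MvPolynomial (Fin n) ℝ) (e : Fin n → ℝ) (hp : ConeLift.IsHyperbolic p e)
    (hdeg : ∀ q : MvPolynomial (Fin n) ℝ, Irreducible q → q ∣ p → q.totalDegree ≤ k) :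
    ¬ ConeLift.HasLift (C : Set E) (ConeLift.hyperbolicityCone p e) := by
  classical
  rintro ⟨π, L, hlift⟩
  rw [ConeLift.hyperbolicityCone_eq hp] at hlift
  have hp0 : p ≠ 0 := by rintro rfl; simpa using hp.pos
  let ι := {q // q ∈ (UniqueFactorizationMonoid.factors p).toFinset}
  have hfac : ∀ i : ι, ∃ r d, d ≤ k ∧ ConeLift.IsHyperbolicOfDegree r d e ∧
      ConeLift.closedCone r e = ConeLift.closedCone i.1 e := fun i =>
    hp.exists_factor hdeg
      (UniqueFactorizationMonoid.irreducible_of_factor _ (Multiset.mem_toFinset.1 i.2))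
      (UniqueFactorizationMonoid.dvd_of_mem_factors (Multiset.mem_toFinset.1 i.2))
  choose r d hdk hr hrcone using hfac
  have hmem : ∀ x, x ∈ ConeLift.closedCone p e ↔ ∀ i, x ∈ ConeLift.closedCone (r i) e := by
    intro x
    rw [ConeLift.mem_closedCone_iff_factors hp0]
    exact ⟨fun h i => hrcone i ▸ h _ (Multiset.mem_toFinset.1 i.2),
      fun h q hq => hrcone ⟨q, Multiset.mem_toFinset.2 hq⟩ ▸ h ⟨q, Multiset.mem_toFinset.2 hq⟩⟩
  have hlifts : ∀ v : E, ∃ y, y ∈ ConeLift.closedCone p e ∧ y ∈ L ∧ (v ∈ C → π y = v) := by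
    intro v
    by_cases hv : v ∈ C
    · have hv' : v ∈ (C : Set E) := hv
      rw [hlift] at hv'
      obtain ⟨y, ⟨hyK, hyL⟩, hy⟩ := hv'
      exact ⟨y, hyK, hyL, fun _ => hy⟩
    · exact ⟨0, ConeLift.zero_mem_closedCone hp, L.zero_mem, fun h => absurd h hv⟩
  choose y hyK hyL hyπ using hlifts
  have hz : ∀ (i : ι) (S : Finset E), ∑ v ∈ S, y v ∈ ConeLift.closedCone (r i) e := by
    intro i S
    refine Finset.sum_induction _ (· ∈ ConeLift.closedCone (r i) e)
      (fun _ _ => (hr i).add_mem) ((hmem 0).1 (ConeLift.zero_mem_closedCone hp) i)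
      fun v _ => (hmem _).1 (hyK v) i
  obtain ⟨M, hM⟩ := ConeLift.exists_card_eq_forall_closure_or_rank_le
    (fun (i : ι) (S : Finset E) => {u : E | ∀ᶠ ε in nhdsWithin (0 : ℝ) (Set.Ioi 0),
      ∑ v ∈ S, y v - ε • y u ∈ ConeLift.closedCone (r i) e})
    (fun i S => d i - ConeLift.IsHyperbolicOfDegree.nullity (r i) e (∑ v ∈ S, y v))
    (by
      intro i S w u hu
      by_cases hw : w ∈ S
      · rwa [Finset.insert_eq_of_mem hw]
      · rw [Set.mem_ofPred_eq] at hu ⊢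
        filter_upwards [hu] with ε hε
        rw [Finset.sum_insert hw, add_sub_assoc]
        exact (hr i).add_mem ((hmem _).1 (hyK w) i) hε)
    (by
      intro i S u huS hu
      have h1 := (hr i).nullity_le (∑ v ∈ S, y v)
      have h2 : ConeLift.IsHyperbolicOfDegree.nullity (r i) e (∑ v ∈ S, y v + y u)
          < ConeLift.IsHyperbolicOfDegree.nullity (r i) e (∑ v ∈ S, y v) := by
        by_contra hlt
        exact hu ((hr i).eventually_sub_mem (hz i S) ((hmem _).1 (hyK u) i) (not_lt.1 hlt))
      rw [Finset.sum_insert huS, add_comm (y u)]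
      omega)
    k 1
  obtain ⟨V, hVext, hVcard, hVn⟩ := hV M
  have hVC : ∀ v ∈ V, v ∈ C := fun v hv =>
    (hVext hv).2.1 ⟨1, zero_le_one, (one_smul ℝ v).symm⟩
  obtain ⟨T, hTV, hTM⟩ := Set.exists_subset_encard_eq hVcard
  have hTfin : T.Finite := Set.finite_of_encard_eq_coe hTM
  obtain ⟨S, hST, A, hAT, hdisj, hSk, hA, hcl⟩ := hM hTfin.toFinset (by
    rw [hTfin.encard_eq_coe_toFinset_card] at hTM
    exact_mod_cast hTM.ge)
  have hSV : ∀ v ∈ S, v ∈ V := fun v hv => hTV (hTfin.mem_toFinset.1 (hST hv))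
  obtain ⟨u, huA⟩ := Finset.card_pos.1 hA
  have huV : u ∈ V := hTV (hTfin.mem_toFinset.1 (hAT huA))
  have huS : u ∉ S := Finset.disjoint_right.1 hdisj huA
  obtain ⟨f, hfC, hfpos, hfzero⟩ := hVn S hSV hSk
  have hall : ∀ i : ι, ∀ᶠ ε in nhdsWithin (0 : ℝ) (Set.Ioi 0),
      ∑ v ∈ S, y v - ε • y u ∈ ConeLift.closedCone (r i) e := by
    intro i
    by_contra hn
    have hk := (hcl i).resolve_left fun h => hn (h huA)
    have h2 : ConeLift.IsHyperbolicOfDegree.nullity (r i) e (∑ v ∈ S, y v + y u)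
        < ConeLift.IsHyperbolicOfDegree.nullity (r i) e (∑ v ∈ S, y v) := by
      by_contra hlt
      exact hn ((hr i).eventually_sub_mem (hz i S) ((hmem _).1 (hyK u) i) (not_lt.1 hlt))
    have := hdk i
    have := (hr i).nullity_le (∑ v ∈ S, y v)
    omega
  obtain ⟨ε, hε, hεpos⟩ := ((Filter.eventually_all.2 hall).and self_mem_nhdsWithin).exists
  have hεpos : 0 < ε := hεpos
  have hCmem : π (∑ v ∈ S, y v - ε • y u) ∈ (C : Set E) := by
    rw [hlift]
    exact ⟨_, ⟨(hmem _).2 hε,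
      L.sub_mem (L.sum_mem fun v _ => hyL v) (L.smul_mem ε (hyL u))⟩, rfl⟩
  have hnonneg := hfC _ hCmem
  rw [map_sub, map_sum, map_smul, hyπ u (hVC u huV), inner_sub_right, inner_sum,
    inner_smul_right, Finset.sum_eq_zero fun v hv => by
      rw [hyπ v (hVC v (hSV v hv)), hfzero v hv]] at hnonneg
  have := mul_pos hεpos (hfpos u huV huS)
  linarith
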